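/- Let $\phi$ and $\Phi$ be the density and the cumulative distribution function of the standard normal distribution. For $\mu\in\mathbb R$, $\eta>0$ and $\rho>0$, let $\mathcal{DTN}(\mu,\eta^2,\rho)$ (the symmetric doubly truncated normal distribution) be the probability distribution on $\mathbb R$ with density $$f(x)=\frac1\eta\,\frac{\phi\left(\frac{x-\mu}{\eta}\right)}{\Phi(\rho)-\Phi(-\rho)}\quad\text{if } x\in[\mu-\rho\eta,\ \mu+\rho\eta],\qquad f(x)=0\quad\text{otherwise}.$$ Let $x_1,x_2,\dots$ be independent real random variables on a probability space with $x_i\sim\mathcal{DTN}(\mu_i,\eta_i^2,\rho_i)$, where the $\mu_i$ are (finite) real numbers, and suppose that there are constants $\underline\rho>0$ and $0<\underline\eta\le\overline\eta<\infty$ such that $\rho_i\ge\underline\rho$ and $\underline\eta\le\eta_i\le\overline\eta$ for all $i$. Put $t_n=\left(\sum_{i=1}^n\operatorname{Var}[x_i]\right)^{1/2}$. Then every $x_i$ is square-integrable, $t_n>0$ for all $n\ge1$, and $$\frac1{t_n}\sum_{i=1}^n(x_i-\mu_i)\ \xrightarrow{d}\ \mathcal N(0,1)\qquad\text{as } n\to\infty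 .$$ -/

import Mathlib

open MeasureTheory ProbabilityTheory Filter Topology

noncomputable section

/-- The density of the standard normal distribution. -/
def stdNormalPDF (x : ℝ) : ℝ := gaussianPDFReal 0 1 x

/-- The cumulative distribution function of the standard normal distribution. -/
def stdNormalCDF (x : ℝ) : ℝ := cdf (gaussianReal 0 1) x

open Classical in
/-- The density of the truncated normal distribution with location `μ`, scale `η` and
truncation interval `[a, b]` (meaningful for `0 < η` and `a < b`). -/
def truncNormalPDF (μ η a b x : ℝ) : ℝ :=
  if x ∈ Set.Icc a b then
    1 / η * (stdNormalPDF ((x - μ) / η) /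
      (stdNormalCDF ((b - μ) / η) - stdNormalCDF ((a - μ) / η)))
  else 0

/-- The truncated normal distribution with location `μ`, scale `η` and truncation interval
`[a, b]`, as a measure on the real line. -/
def truncNormal (μ η a b : ℝ) : Measure ℝ :=
  volume.withDensity fun x => ENNReal.ofReal (truncNormalPDF μ η a b x)

/-- The symmetric doubly truncated normal distribution with location `μ`, scale `η` (the second
parameter in the usual notation is `η ^ 2`) and truncation parameter `ρ`: the normal distribution
truncated to `[μ - ρ * η, μ + ρ * η]`. -/
def doublyTruncNormal (μ η ρ : ℝ) : Measure ℝ :=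
  truncNormal μ η (μ - ρ * η) (μ + ρ * η)

end

/-! Put c = Φ(ρ_min) - Φ(-ρ_min) > 0. Truncating at ρ ≥ ρ_min multiplies the normal density by at
most 1/c, so every law is dominated by c⁻¹ · N(μ_i, η_i²). This bounds the third absolute moments
about μ_i by a constant K, since η_i ≤ η_max. It also bounds the densities by c⁻¹/η_min, so no law
can concentrate and the variances stay above some v > 0. Symmetry makes x_i - μ_i centered.

Hence ∑ E|x_i - μ_i|³ ≤ nK while t_n³ ≥ (nv)^(3/2), which is Lyapunov's condition. The limit theorem
itself, `tendstoInDistribution_of_integral_abs_pow_three_le`, compares characteristic functions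
factor by factor with those of centered Gaussians of the same variances, and concludes by Lévy's
continuity theorem. -/

open Complex in
lemma norm_exp_mul_I_sub_taylor_two_le (x : ℝ) :
    ‖Complex.exp (x * I) - (1 + x * I - x ^ 2 / 2)‖ ≤ 4 * |x| ^ 3 := by
  have hn : ‖(x : ℂ) * I‖ = |x| := by simp
  rcases le_total |x| 1 with hx | hx
  · have h := Complex.exp_bound (x := x * I) (by rwa [hn]) (n := 3) (by norm_num)
    rw [hn] at h
    have hs : ∑ m ∈ Finset.range 3, ((x : ℂ) * I) ^ m / (m.factorial : ℂ) =
        1 + x * I - x ^ 2 / 2 := by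
      simp [Finset.sum_range_succ, mul_pow, Nat.factorial]
      ring
    rw [hs] at h
    refine h.trans ?_
    rw [mul_comm]
    gcongr
    norm_num [Nat.factorial]
  -- The constant 4 comes from this range: 1 + 1 + |x| + x²/2 ≤ 4|x|³ once |x| ≥ 1.
  · have h1 : ‖Complex.exp (x * I)‖ = 1 := Complex.norm_exp_ofReal_mul_I x
    have h2 : ‖(x : ℂ) ^ 2 / 2‖ = |x| ^ 2 / 2 := by simp
    have h3 := norm_sub_le (Complex.exp (x * I)) (1 + x * I - x ^ 2 / 2)
    have h4 := norm_sub_le (1 + (x : ℂ) * I) (x ^ 2 / 2)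
    have h5 := norm_add_le (1 : ℂ) (x * I)
    rw [norm_one] at h5
    have h6 := pow_le_pow_right₀ hx (show 2 ≤ 3 by norm_num)
    have h7 := pow_le_pow_right₀ hx (show 1 ≤ 3 by norm_num)
    have h8 := one_le_pow₀ (n := 3) hx
    linarith

/-- Swap one factor at a time; the untouched factors have norm at most 1. -/
lemma norm_prod_sub_prod_le_sum {ι R : Type*} [NormedCommRing R] [NormOneClass R] (s : Finset ι)
    (f g : ι → R) (hf : ∀ i ∈ s, ‖f i‖ ≤ 1) (hg : ∀ i ∈ s, ‖g i‖ ≤ 1) :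
    ‖∏ i ∈ s, f i - ∏ i ∈ s, g i‖ ≤ ∑ i ∈ s, ‖f i - g i‖ := by
  classical
  induction s using Finset.induction with
  | empty => simp
  | insert a s ha ih =>
    rw [Finset.prod_insert ha, Finset.prod_insert ha, Finset.sum_insert ha]
    have hf' : ∀ i ∈ s, ‖f i‖ ≤ 1 := fun i hi ↦ hf i (Finset.mem_insert_of_mem hi)
    have hg' : ∀ i ∈ s, ‖g i‖ ≤ 1 := fun i hi ↦ hg i (Finset.mem_insert_of_mem hi)
    have hp : ‖∏ i ∈ s, f i‖ ≤ 1 := (s.norm_prod_le f).trans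
      (Finset.prod_le_one (fun _ _ ↦ norm_nonneg _) hf')
    have e : f a * ∏ i ∈ s, f i - g a * ∏ i ∈ s, g i =
      (f a - g a) * ∏ i ∈ s, f i + g a * (∏ i ∈ s, f i - ∏ i ∈ s, g i) := by ring
    rw [e]
    refine (norm_add_le _ _).trans (add_le_add ?_ ?_)
    · exact (norm_mul_le _ _).trans (mul_le_of_le_one_right (norm_nonneg _) hp)
    · exact (norm_mul_le _ _).trans ((mul_le_of_le_one_left (norm_nonneg _)
        (hg a (Finset.mem_insert_self _ _))).trans (ih hf' hg'))

/-! ### Lyapunov's theorem by characteristic functions -/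

section Lyapunov

variable {Ω : Type*} [MeasurableSpace Ω] {P : Measure Ω} [IsProbabilityMeasure P]

lemma integrable_pow_of_integrable_abs_pow {Y : Ω → ℝ} (hY : AEMeasurable Y P) {m n : ℕ}
    (hmn : m ≤ n) (h : Integrable (fun ω ↦ |Y ω| ^ n) P) : Integrable (fun ω ↦ Y ω ^ m) P := by
  refine (h.add (integrable_const (1 : ℝ))).mono' (hY.pow_const m).aestronglyMeasurable
    (ae_of_all _ fun ω ↦ ?_)
  rw [norm_pow, Real.norm_eq_abs]
  change |Y ω| ^ m ≤ |Y ω| ^ n + 1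
  rcases le_total |Y ω| 1 with h1 | h1
  · have := pow_le_one₀ (n := m) (abs_nonneg (Y ω)) h1
    have := pow_nonneg (abs_nonneg (Y ω)) n
    linarith
  · have := pow_le_pow_right₀ h1 hmn
    linarith

open Complex in
lemma norm_charFun_sub_taylor_two_le {Y : Ω → ℝ} (hY : AEMeasurable Y P) (h0 : ∫ ω, Y ω ∂P = 0)
    (h3 : Integrable (fun ω ↦ |Y ω| ^ 3) P) (t : ℝ) :
    ‖charFun (P.map Y) t - (1 - ((∫ ω, Y ω ^ 2 ∂P : ℝ) : ℂ) * t ^ 2 / 2)‖ ≤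
      4 * |t| ^ 3 * ∫ ω, |Y ω| ^ 3 ∂P := by
  have i1 : Integrable Y P := by
    simpa using integrable_pow_of_integrable_abs_pow hY (show 1 ≤ 3 by norm_num) h3
  have i2 := integrable_pow_of_integrable_abs_pow hY (show 2 ≤ 3 by norm_num) h3
  have iE : Integrable (fun ω ↦ Complex.exp (((t * Y ω : ℝ) : ℂ) * I)) P := by
    refine (integrable_const (1 : ℝ)).mono' (by fun_prop) (ae_of_all _ fun ω ↦ ?_)
    rw [Complex.norm_exp_ofReal_mul_I]
  have j1 : Integrable (fun ω ↦ ((t * Y ω : ℝ) : ℂ) * I) P := ((i1.const_mul t).ofReal).mul_const I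
  have j2 : Integrable (fun ω ↦ ((t * Y ω : ℝ) : ℂ) ^ 2 / 2) P := by
    have : Integrable (fun ω ↦ ((t ^ 2 / 2 * Y ω ^ 2 : ℝ) : ℂ)) P := (i2.const_mul _).ofReal
    refine this.congr (ae_of_all _ fun ω ↦ ?_)
    push_cast
    ring
  have e : charFun (P.map Y) t - (1 - ((∫ ω, Y ω ^ 2 ∂P : ℝ) : ℂ) * t ^ 2 / 2) =
      ∫ ω, (Complex.exp (((t * Y ω : ℝ) : ℂ) * I) -
        (1 + ((t * Y ω : ℝ) : ℂ) * I - ((t * Y ω : ℝ) : ℂ) ^ 2 / 2)) ∂P := by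
    have k1 : ∫ ω, ((t * Y ω : ℝ) : ℂ) * I ∂P = 0 := by
      rw [integral_mul_const, integral_complex_ofReal, integral_const_mul, h0]
      simp
    have k2 : ∫ ω, ((t * Y ω : ℝ) : ℂ) ^ 2 / 2 ∂P = ((∫ ω, Y ω ^ 2 ∂P : ℝ) : ℂ) * t ^ 2 / 2 := by
      rw [integral_div, ← integral_complex_ofReal, ← integral_mul_const]
      congr 2
      ext ω
      push_cast
      ring
    have j3 : Integrable (fun ω ↦ 1 + ((t * Y ω : ℝ) : ℂ) * I) P := (integrable_const _).add j1
    have j4 : Integrable (fun ω ↦ 1 + ((t * Y ω : ℝ) : ℂ) * I - ((t * Y ω : ℝ) : ℂ) ^ 2 / 2) P :=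
      j3.sub j2
    rw [integral_sub iE j4, integral_sub j3 j2, integral_add (integrable_const _) j1, k1, k2,
      charFun_apply_real, integral_map hY (by fun_prop)]
    simp
  rw [e, ← integral_const_mul]
  refine norm_integral_le_of_norm_le (h3.const_mul _) (ae_of_all _ fun ω ↦ ?_)
  refine (norm_exp_mul_I_sub_taylor_two_le _).trans_eq ?_
  rw [abs_mul]
  ring

lemma abs_exp_neg_sub_one_add_le {u : ℝ} (hu : 0 ≤ u) : |Real.exp (-u) - (1 - u)| ≤ 2 * u ^ 2 := by
  rcases le_total u 1 with h | h
  · have := Real.norm_exp_sub_one_sub_id_le (x := -u) (by simpa [abs_of_nonneg hu] using h)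
    rw [Real.norm_eq_abs, Real.norm_eq_abs, abs_neg, sq_abs] at this
    rw [show Real.exp (-u) - (1 - u) = Real.exp (-u) - 1 - -u by ring]
    nlinarith [sq_nonneg u]
  · have h1 := Real.exp_pos (-u)
    have h2 : Real.exp (-u) ≤ 1 := Real.exp_le_one_iff.2 (by linarith)
    rw [abs_le]
    constructor <;> nlinarith

/-- Both terms are close to 1 - Var[Y] t²/2: the first by Taylor expansion under the integral, the
second by `abs_exp_neg_sub_one_add_le`. -/
lemma norm_charFun_sub_exp_le {Y : Ω → ℝ} (hY : AEMeasurable Y P) (h0 : ∫ ω, Y ω ∂P = 0)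
    (h3 : Integrable (fun ω ↦ |Y ω| ^ 3) P) (t : ℝ) :
    ‖charFun (P.map Y) t - ((Real.exp (-(Var[Y; P] * t ^ 2 / 2)) : ℝ) : ℂ)‖ ≤
      4 * |t| ^ 3 * ∫ ω, |Y ω| ^ 3 ∂P + Var[Y; P] ^ 2 * t ^ 4 := by
  have hv : Var[Y; P] = ∫ ω, Y ω ^ 2 ∂P := variance_of_integral_eq_zero hY h0
  have hv0 : 0 ≤ Var[Y; P] := variance_nonneg _ _
  have h1 := norm_charFun_sub_taylor_two_le hY h0 h3 t
  rw [← hv] at h1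
  have h2 := abs_exp_neg_sub_one_add_le (u := Var[Y; P] * t ^ 2 / 2) (by positivity)
  rw [← Real.norm_eq_abs, ← Complex.norm_real, Complex.ofReal_sub, norm_sub_rev] at h2
  have := norm_sub_le_norm_sub_add_norm_sub (charFun (P.map Y) t)
    (1 - (Var[Y; P] : ℂ) * t ^ 2 / 2) ((Real.exp (-(Var[Y; P] * t ^ 2 / 2)) : ℝ) : ℂ)
  push_cast at h2 this ⊢
  have : 2 * (Var[Y; P] * t ^ 2 / 2) ^ 2 ≤ Var[Y; P] ^ 2 * t ^ 4 := by
    have : 0 ≤ Var[Y; P] ^ 2 * t ^ 4 := by positivity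
    linarith
  linarith

lemma variance_le_of_integral_abs_pow_three_le {Y : Ω → ℝ} (hY : AEMeasurable Y P)
    (h0 : ∫ ω, Y ω ∂P = 0) (h3 : Integrable (fun ω ↦ |Y ω| ^ 3) P) {K : ℝ}
    (hK : ∫ ω, |Y ω| ^ 3 ∂P ≤ K) : Var[Y; P] ≤ K + 1 := by
  rw [variance_of_integral_eq_zero hY h0]
  have i2 := integrable_pow_of_integrable_abs_pow hY (show 2 ≤ 3 by norm_num) h3
  have h : ∫ ω, Y ω ^ 2 ∂P ≤ ∫ ω, (|Y ω| ^ 3 + 1) ∂P := by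
    refine integral_mono i2 (h3.add (integrable_const (1 : ℝ))) fun ω ↦ ?_
    change Y ω ^ 2 ≤ |Y ω| ^ 3 + 1
    rw [← sq_abs]
    have ha := abs_nonneg (Y ω)
    nlinarith [sq_nonneg (|Y ω| - 1), mul_nonneg ha (sq_nonneg (|Y ω| - 1))]
  rw [integral_add h3 (integrable_const _)] at h
  simp only [integral_const, probReal_univ, smul_eq_mul, mul_one] at h
  linarith

lemma norm_charFun_normalized_sum_sub_exp_le {Y : ℕ → Ω → ℝ}
    (hY : ∀ i, AEMeasurable (Y i) P) (hindep : iIndepFun Y P) (h0 : ∀ i, ∫ ω, Y i ω ∂P = 0)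
    (h3 : ∀ i, Integrable (fun ω ↦ |Y i ω| ^ 3) P) {K : ℝ} (hK : ∀ i, ∫ ω, |Y i ω| ^ 3 ∂P ≤ K)
    (n : ℕ) {s : ℝ} (hs : 0 < s) (hsq : s ^ 2 = ∑ i ∈ Finset.range n, Var[Y i; P]) (t : ℝ) :
    ‖charFun (P.map fun ω ↦ 1 / s * ∑ i ∈ Finset.range n, Y i ω) t -
      ((Real.exp (-(t ^ 2 / 2)) : ℝ) : ℂ)‖ ≤
    n * (4 * |1 / s * t| ^ 3 * K + (K + 1) ^ 2 * (1 / s * t) ^ 4) := by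
  have hchar : charFun (P.map fun ω ↦ 1 / s * ∑ i ∈ Finset.range n, Y i ω) t =
      ∏ i ∈ Finset.range n, charFun (P.map (Y i)) (1 / s * t) := by
    rw [charFun_map_mul_comp (Finset.aemeasurable_fun_sum _ fun _ _ ↦ hY _),
      (hindep.restrict _).charFun_map_fun_finsetSum_eq_prod (fun _ _ ↦ hY _), Finset.prod_apply]
  -- The Gaussian factors multiply exactly to the limit because the variances sum to s².
  have hprod : ((Real.exp (-(t ^ 2 / 2)) : ℝ) : ℂ) = ∏ i ∈ Finset.range n,
      ((Real.exp (-(Var[Y i; P] * (1 / s * t) ^ 2 / 2)) : ℝ) : ℂ) := by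
    rw [← Complex.ofReal_prod, ← Real.exp_sum]
    congr 2
    rw [Finset.sum_neg_distrib, ← Finset.sum_div, ← Finset.sum_mul, ← hsq]
    field_simp
  rw [hchar, hprod]
  refine (norm_prod_sub_prod_le_sum _ _ _ (fun i _ ↦ ?_) (fun i _ ↦ ?_)).trans ?_
  · have : IsProbabilityMeasure (P.map (Y i)) := Measure.isProbabilityMeasure_map (hY i)
    exact norm_charFun_le_one _
  · rw [Complex.norm_real, Real.norm_eq_abs, abs_of_pos (Real.exp_pos _), Real.exp_le_one_iff,
      neg_nonpos]
    have := variance_nonneg (Y i) P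
    positivity
  refine (Finset.sum_le_card_nsmul _ _ _ fun i _ ↦ ?_).trans_eq
    (by rw [Finset.card_range, nsmul_eq_mul])
  refine (norm_charFun_sub_exp_le (hY i) (h0 i) (h3 i) _).trans (add_le_add ?_ ?_)
  · exact mul_le_mul_of_nonneg_left (hK i) (by positivity)
  · exact mul_le_mul_of_nonneg_right (pow_le_pow_left₀ (variance_nonneg _ _)
      (variance_le_of_integral_abs_pow_three_le (hY i) (h0 i) (h3 i) (hK i)) 2) (by positivity)

/-- **Lyapunov's central limit theorem** for centered independent random variables with variances
bounded below and third absolute moments bounded above. -/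
theorem tendstoInDistribution_of_integral_abs_pow_three_le {Y : ℕ → Ω → ℝ}
    (hY : ∀ i, AEMeasurable (Y i) P) (hindep : iIndepFun Y P) (h0 : ∀ i, ∫ ω, Y i ω ∂P = 0)
    (h3 : ∀ i, Integrable (fun ω ↦ |Y i ω| ^ 3) P) {K v : ℝ} (hK : ∀ i, ∫ ω, |Y i ω| ^ 3 ∂P ≤ K)
    (hv : 0 < v) (hvar : ∀ i, v ≤ Var[Y i; P]) :
    TendstoInDistribution
      (fun (n : ℕ) ω ↦ 1 / √(∑ i ∈ Finset.range n, Var[Y i; P]) * ∑ i ∈ Finset.range n, Y i ω)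
      atTop (id : ℝ → ℝ) (fun _ ↦ P) (gaussianReal 0 1) where
  forall_aemeasurable n := .const_mul (Finset.aemeasurable_fun_sum _ fun _ _ ↦ hY _) _
  tendsto := by
    refine ProbabilityMeasure.tendsto_iff_tendsto_charFun.2 fun t ↦ ?_
    have hK0 : 0 ≤ K := (integral_nonneg fun ω ↦ by positivity).trans (hK 0)
    set s : ℕ → ℝ := fun n ↦ √(∑ i ∈ Finset.range n, Var[Y i; P]) with hs
    have hsq (n : ℕ) : s n ^ 2 = ∑ i ∈ Finset.range n, Var[Y i; P] :=
      Real.sq_sqrt (Finset.sum_nonneg fun _ _ ↦ variance_nonneg _ _)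
    have hlow (n : ℕ) : n * v ≤ s n ^ 2 := by
      rw [hsq]
      simpa using Finset.card_nsmul_le_sum (Finset.range n) _ v (fun i _ ↦ hvar i)
    have hslim : Tendsto s atTop atTop := by
      refine tendsto_atTop_mono (fun n ↦ Real.le_sqrt_of_sq_le ?_)
        (Real.tendsto_sqrt_atTop.comp (tendsto_natCast_atTop_atTop.atTop_mul_const hv))
      rw [Function.comp_apply, Real.sq_sqrt (by positivity), ← hsq]
      exact hlow n
    -- Using n ≤ s²/v, the error terms n/s³ and n/s⁴ become O(1/s) and O(1/s²).
    have hbound : ∀ᶠ n in atTop,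
        ‖charFun (P.map fun ω ↦ 1 / s n * ∑ i ∈ Finset.range n, Y i ω) t -
          ((Real.exp (-(t ^ 2 / 2)) : ℝ) : ℂ)‖ ≤
        (4 * |t| ^ 3 * K / v) * (s n)⁻¹ + ((K + 1) ^ 2 * t ^ 4 / v) * (s n)⁻¹ ^ 2 := by
      filter_upwards [hslim.eventually_gt_atTop 0] with n hn
      refine (norm_charFun_normalized_sum_sub_exp_le hY hindep h0 h3 hK n hn (hsq n) t).trans ?_
      have hnv : (n : ℝ) ≤ s n ^ 2 / v := (le_div_iff₀ hv).2 (hlow n)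
      refine (mul_le_mul_of_nonneg_right hnv (by positivity)).trans_eq ?_
      rw [abs_mul, abs_of_pos (by positivity : 0 < 1 / s n)]
      field_simp
    have hzero : Tendsto (fun n ↦ (4 * |t| ^ 3 * K / v) * (s n)⁻¹ +
        ((K + 1) ^ 2 * t ^ 4 / v) * (s n)⁻¹ ^ 2) atTop (𝓝 0) := by
      have hinv := tendsto_inv_atTop_zero.comp hslim
      simpa using (hinv.const_mul (4 * |t| ^ 3 * K / v)).add
        ((hinv.pow 2).const_mul ((K + 1) ^ 2 * t ^ 4 / v))
    have hlim := tendsto_iff_norm_sub_tendsto_zero.2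
      (squeeze_zero' (Eventually.of_forall fun _ ↦ norm_nonneg _) hbound hzero)
    have hgauss : charFun ((gaussianReal 0 1).map (id : ℝ → ℝ)) t =
        ((Real.exp (-(t ^ 2 / 2)) : ℝ) : ℂ) := by
      rw [Measure.map_id, charFun_gaussianReal]
      simp
    simpa only [ProbabilityMeasure.coe_mk, hgauss] using hlim

end Lyapunov

/-! ### Moment and density bounds for the truncated normal law -/

section TruncatedNormal

lemma stdNormalCDF_sub_eq_measureReal {a b : ℝ} (hab : a ≤ b) :
    stdNormalCDF b - stdNormalCDF a = (gaussianReal 0 1).real (Set.Ioc a b) := by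
  have h : Set.Ioc a b = Set.Iic b \ Set.Iic a := by
    ext x
    simp [and_comm]
  rw [stdNormalCDF, stdNormalCDF, cdf_eq_real, cdf_eq_real, h,
    measureReal_sdiff (Set.Iic_subset_Iic.2 hab) measurableSet_Iic]

lemma stdNormalCDF_strictMono : StrictMono stdNormalCDF := by
  intro a b hab
  rw [← sub_pos, stdNormalCDF_sub_eq_measureReal hab.le, measureReal_def, ENNReal.toReal_pos_iff]
  refine ⟨pos_iff_ne_zero.2 fun h ↦ ?_, measure_lt_top _ _⟩
  have := gaussianReal_absolutelyContinuous' 0 one_ne_zero h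
  rw [Real.volume_Ioc, ENNReal.ofReal_eq_zero] at this
  linarith

lemma one_div_mul_stdNormalPDF (μ x : ℝ) {η : ℝ} (hη : 0 < η) :
    1 / η * stdNormalPDF ((x - μ) / η) = gaussianPDFReal μ (Real.toNNReal (η ^ 2)) x := by
  have h : √(2 * Real.pi * η ^ 2) = √(2 * Real.pi) * η := by
    rw [Real.sqrt_mul (by positivity), Real.sqrt_sq hη.le]
  simp only [stdNormalPDF, gaussianPDFReal, NNReal.coe_one, mul_one, sub_zero,
    Real.coe_toNNReal _ (sq_nonneg η), h]
  have e : -((x - μ) / η) ^ 2 / 2 = -(x - μ) ^ 2 / (2 * η ^ 2) := by field_simp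
  rw [e]
  field_simp

lemma stdNormalPDF_le_one (x : ℝ) : stdNormalPDF x ≤ 1 := by
  simp only [stdNormalPDF, gaussianPDFReal, NNReal.coe_one, mul_one, sub_zero]
  refine mul_le_one₀ (inv_le_one_of_one_le₀ ?_) (Real.exp_pos _).le
    (Real.exp_le_one_iff.2 (by nlinarith [sq_nonneg x]))
  exact Real.one_le_sqrt.2 (by linarith [Real.pi_gt_three])

@[fun_prop]
lemma measurable_truncNormalPDF (μ η a b : ℝ) : Measurable (truncNormalPDF μ η a b) := by
  classical
  unfold truncNormalPDF stdNormalPDF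
  exact Measurable.ite measurableSet_Icc (by fun_prop) measurable_const

variable {μ η ρ ρ_min : ℝ}

/-- The normalizing mass Φ(ρ) - Φ(-ρ) increases with ρ, so its value at ρ_min serves uniformly. -/
lemma truncNormalPDF_symm_le (hη : 0 < η) (hρ_min : 0 < ρ_min) (hρ : ρ_min ≤ ρ) (x : ℝ) :
    truncNormalPDF μ η (μ - ρ * η) (μ + ρ * η) x ≤
      (stdNormalCDF ρ_min - stdNormalCDF (-ρ_min))⁻¹ * (1 / η * stdNormalPDF ((x - μ) / η)) := by
  have hc : 0 < stdNormalCDF ρ_min - stdNormalCDF (-ρ_min) :=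
    sub_pos.2 (stdNormalCDF_strictMono (by linarith))
  have hφ : 0 ≤ stdNormalPDF ((x - μ) / η) := gaussianPDFReal_nonneg _ _ _
  unfold truncNormalPDF
  split_ifs
  · have e1 : (μ + ρ * η - μ) / η = ρ := by field_simp; ring
    have e2 : (μ - ρ * η - μ) / η = -ρ := by field_simp; ring
    rw [e1, e2, ← mul_div_assoc, div_eq_inv_mul]
    have hmono := stdNormalCDF_strictMono.monotone
    have := hmono hρ
    have := hmono (neg_le_neg hρ)
    gcongr
  · positivity

lemma doublyTruncNormal_le_gaussianReal (hη : 0 < η) (hρ_min : 0 < ρ_min) (hρ : ρ_min ≤ ρ) :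
    doublyTruncNormal μ η ρ ≤
      ENNReal.ofReal (stdNormalCDF ρ_min - stdNormalCDF (-ρ_min))⁻¹ •
        gaussianReal μ (Real.toNNReal (η ^ 2)) := by
  have hv : Real.toNNReal (η ^ 2) ≠ 0 := (Real.toNNReal_pos.2 (by positivity)).ne'
  have hc : 0 < stdNormalCDF ρ_min - stdNormalCDF (-ρ_min) :=
    sub_pos.2 (stdNormalCDF_strictMono (by linarith))
  rw [gaussianReal_of_var_ne_zero _ hv, ← withDensity_smul _ (measurable_gaussianPDF _ _)]
  refine withDensity_mono (ae_of_all _ fun x ↦ ?_)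
  rw [Pi.smul_apply, smul_eq_mul, gaussianPDF, ← ENNReal.ofReal_mul (by positivity),
    ← one_div_mul_stdNormalPDF _ _ hη]
  exact ENNReal.ofReal_le_ofReal (truncNormalPDF_symm_le hη hρ_min hρ x)

lemma integral_sub_doublyTruncNormal :
    ∫ x, (x - μ) ∂(doublyTruncNormal μ η ρ) = 0 := by
  -- The reflection x ↦ 2μ - x preserves the density and flips the sign of x - μ, so the integral
  -- equals its own negative.
  have hpdf (x : ℝ) : truncNormalPDF μ η (μ - ρ * η) (μ + ρ * η) (2 * μ - x) =
      truncNormalPDF μ η (μ - ρ * η) (μ + ρ * η) x := by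
    have h1 : 2 * μ - x ∈ Set.Icc (μ - ρ * η) (μ + ρ * η) ↔
        x ∈ Set.Icc (μ - ρ * η) (μ + ρ * η) := by
      simp only [Set.mem_Icc]
      constructor <;> rintro ⟨_, _⟩ <;> constructor <;> linarith
    have h2 : stdNormalPDF ((2 * μ - x - μ) / η) = stdNormalPDF ((x - μ) / η) := by
      simp only [stdNormalPDF, gaussianPDFReal, sub_zero]
      rw [show (2 * μ - x - μ) / η = -((x - μ) / η) by ring, neg_sq]
    simp only [truncNormalPDF, h1, h2]
  rw [doublyTruncNormal, truncNormal, integral_withDensity_eq_integral_toReal_smul (by fun_prop)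
    (ae_of_all _ fun _ ↦ ENNReal.ofReal_lt_top)]
  have h := integral_sub_left_eq_self (fun x ↦ (ENNReal.ofReal
    (truncNormalPDF μ η (μ - ρ * η) (μ + ρ * η) x)).toReal • (x - μ)) volume (2 * μ)
  simp only [hpdf, smul_eq_mul] at h ⊢
  rw [← self_eq_neg, ← integral_neg, ← h]
  exact integral_congr_ae (ae_of_all _ fun x ↦ by ring_nf)

lemma integrable_abs_pow_three_gaussianReal :
    Integrable (fun z : ℝ ↦ |z| ^ 3) (gaussianReal 0 1) := by
  simpa using (memLp_id_gaussianReal (μ := 0) (v := 1) 3).integrable_norm_pow (p := 3) (by simp)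

lemma hasLaw_sub_div_gaussianReal (hη : 0 < η) :
    HasLaw (fun x ↦ (x - μ) / η) (gaussianReal 0 1) (gaussianReal μ (Real.toNNReal (η ^ 2))) := by
  have h := gaussianReal_div_const (gaussianReal_sub_const
    (HasLaw.id (μ := gaussianReal μ (Real.toNNReal (η ^ 2)))) μ) η
  convert! h using 2
  · simp
  · ext
    simp [hη.ne', sq_nonneg]

lemma integrable_abs_sub_pow_three_gaussianReal (hη : 0 < η) :
    Integrable (fun x ↦ |x - μ| ^ 3) (gaussianReal μ (Real.toNNReal (η ^ 2))) := by
  have h := hasLaw_sub_div_gaussianReal (μ := μ) hη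
  have hi := integrable_abs_pow_three_gaussianReal
  rw [← h.map_eq, integrable_map_measure (by fun_prop) h.aemeasurable] at hi
  refine (hi.const_mul (η ^ 3)).congr (ae_of_all _ fun x ↦ ?_)
  simp only [Function.comp_apply, abs_div, abs_of_pos hη]
  field_simp

lemma integral_abs_sub_pow_three_gaussianReal (hη : 0 < η) :
    ∫ x, |x - μ| ^ 3 ∂(gaussianReal μ (Real.toNNReal (η ^ 2))) =
      η ^ 3 * ∫ z, |z| ^ 3 ∂(gaussianReal 0 1) := by
  have h := (hasLaw_sub_div_gaussianReal (μ := μ) hη).integral_comp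
    (f := fun z : ℝ ↦ |z| ^ 3) (by fun_prop)
  rw [← h, ← integral_const_mul]
  refine integral_congr_ae (ae_of_all _ fun x ↦ ?_)
  simp only [Function.comp_apply, abs_div, abs_of_pos hη]
  field_simp

lemma integrable_abs_sub_pow_three_doublyTruncNormal (hη : 0 < η) (hρ : 0 < ρ) :
    Integrable (fun x ↦ |x - μ| ^ 3) (doublyTruncNormal μ η ρ) :=
  ((integrable_abs_sub_pow_three_gaussianReal hη).smul_measure ENNReal.ofReal_ne_top).mono_measure
    (doublyTruncNormal_le_gaussianReal hη hρ le_rfl)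

lemma integral_abs_sub_pow_three_doublyTruncNormal_le (hη : 0 < η) (hρ_min : 0 < ρ_min)
    (hρ : ρ_min ≤ ρ) :
    ∫ x, |x - μ| ^ 3 ∂(doublyTruncNormal μ η ρ) ≤
      (stdNormalCDF ρ_min - stdNormalCDF (-ρ_min))⁻¹ *
        (η ^ 3 * ∫ z, |z| ^ 3 ∂(gaussianReal 0 1)) := by
  have hc : 0 < stdNormalCDF ρ_min - stdNormalCDF (-ρ_min) :=
    sub_pos.2 (stdNormalCDF_strictMono (by linarith))
  refine (integral_mono_measure (doublyTruncNormal_le_gaussianReal hη hρ_min hρ)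
    (ae_of_all _ fun x ↦ by positivity)
    ((integrable_abs_sub_pow_three_gaussianReal hη).smul_measure ENNReal.ofReal_ne_top)).trans_eq ?_
  rw [integral_smul_measure, integral_abs_sub_pow_three_gaussianReal hη,
    ENNReal.toReal_ofReal (by positivity), smul_eq_mul]

/-- A probability measure whose density with respect to Lebesgue measure is at most `D` cannot
concentrate near a point. -/
lemma le_integral_sq_sub_of_le_smul_volume {ν : Measure ℝ} [IsProbabilityMeasure ν] {D : ℝ}
    (hD : 0 < D) (hν : ν ≤ ENNReal.ofReal D • volume) (m : ℝ)
    (hint : Integrable (fun x ↦ (x - m) ^ 2) ν) :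
    1 / (32 * D ^ 2) ≤ ∫ x, (x - m) ^ 2 ∂ν := by
  -- The interval of radius δ has length 1/(2D), hence mass at most 1/2; Chebyshev's inequality on
  -- the complement gives δ²/2 = 1/(32D²).
  set δ : ℝ := 1 / (4 * D) with hδ
  have hδ0 : 0 < δ := by positivity
  have hball : ν.real (Set.Ioo (m - δ) (m + δ)) ≤ 1 / 2 := by
    have h := hν (Set.Ioo (m - δ) (m + δ))
    rw [Measure.smul_apply, Real.volume_Ioo, smul_eq_mul, ← ENNReal.ofReal_mul hD.le] at h
    refine ENNReal.toReal_le_of_le_ofReal (by norm_num) (h.trans_eq ?_)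
    congr 1
    rw [hδ]
    field_simp
    ring
  have hcompl := probReal_add_probReal_compl (μ := ν) (measurableSet_Ioo (a := m - δ) (b := m + δ))
  have hcheb := mul_meas_ge_le_integral_of_nonneg
    (ae_of_all ν fun x ↦ sq_nonneg (x - m)) hint (δ ^ 2)
  have hsub : (Set.Ioo (m - δ) (m + δ))ᶜ ⊆ {x | δ ^ 2 ≤ (x - m) ^ 2} := by
    intro x hx
    rw [Set.mem_ofPred_eq]
    by_contra! h
    have := abs_lt.1 (abs_lt_of_sq_lt_sq h hδ0.le)
    exact hx ⟨by linarith, by linarith⟩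
  have hmono := measureReal_mono (μ := ν) hsub
  have h2 : δ ^ 2 * (1 / 2) ≤ ∫ x, (x - m) ^ 2 ∂ν :=
    (mul_le_mul_of_nonneg_left (by linarith) (sq_nonneg δ)).trans hcheb
  refine le_trans (le_of_eq ?_) h2
  rw [hδ]
  field_simp
  norm_num

lemma doublyTruncNormal_le_smul_volume {η_min : ℝ} (hη_min : 0 < η_min) (hη : η_min ≤ η)
    (hρ_min : 0 < ρ_min) (hρ : ρ_min ≤ ρ) :
    doublyTruncNormal μ η ρ ≤ ENNReal.ofReal
      ((stdNormalCDF ρ_min - stdNormalCDF (-ρ_min))⁻¹ * (1 / η_min)) • volume := by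
  have hc : 0 < stdNormalCDF ρ_min - stdNormalCDF (-ρ_min) :=
    sub_pos.2 (stdNormalCDF_strictMono (by linarith))
  have hη0 : 0 < η := hη_min.trans_le hη
  rw [← withDensity_const]
  refine withDensity_mono (ae_of_all _ fun x ↦ ENNReal.ofReal_le_ofReal ?_)
  refine (truncNormalPDF_symm_le hη0 hρ_min hρ x).trans
    (mul_le_mul_of_nonneg_left ?_ (by positivity))
  calc 1 / η * stdNormalPDF ((x - μ) / η) ≤ 1 / η * 1 := by
        gcongr
        exact stdNormalPDF_le_one _
    _ ≤ 1 / η_min := by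
        rw [mul_one]
        gcongr

end TruncatedNormal

theorem theorem1 {Ω : Type*} [MeasurableSpace Ω] (P : Measure Ω) [IsProbabilityMeasure P]
    (X : ℕ → Ω → ℝ) (μ η ρ : ℕ → ℝ) (ρ_min η_min η_max : ℝ)
    (hρ_min : 0 < ρ_min) (hρ : ∀ i, ρ_min ≤ ρ i)
    (hη_min : 0 < η_min) (hη : ∀ i, η_min ≤ η i ∧ η i ≤ η_max)
    (hX : ∀ i, HasLaw (X i) (doublyTruncNormal (μ i) (η i) (ρ i)) P)
    (hindep : iIndepFun X P) :
    (∀ i, MemLp (X i) 2 P) ∧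
    (∀ n : ℕ, 1 ≤ n → 0 < √(∑ i ∈ Finset.range n, Var[X i; P])) ∧
    TendstoInDistribution
      (fun (n : ℕ) (ω : Ω) =>
        1 / √(∑ i ∈ Finset.range n, Var[X i; P]) * ∑ i ∈ Finset.range n, (X i ω - μ i))
      atTop (id : ℝ → ℝ) (fun _ => P) (gaussianReal 0 1) := by
  have hη0 (i : ℕ) : 0 < η i := hη_min.trans_le (hη i).1
  have hρ0 (i : ℕ) : 0 < ρ i := hρ_min.trans_le (hρ i)
  have hc : 0 < stdNormalCDF ρ_min - stdNormalCDF (-ρ_min) :=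
    sub_pos.2 (stdNormalCDF_strictMono (by linarith))
  set Y : ℕ → Ω → ℝ := fun i ω ↦ X i ω - μ i with hYdef
  have hXm (i : ℕ) : AEMeasurable (X i) P := (hX i).aemeasurable
  have hYm (i : ℕ) : AEMeasurable (Y i) P := (hXm i).sub_const _
  have hYi : iIndepFun Y P := hindep.comp (fun i x ↦ x - μ i) (by fun_prop)
  have hY0 (i : ℕ) : ∫ ω, Y i ω ∂P = 0 :=
    ((hX i).integral_comp (f := fun x ↦ x - μ i) (by fun_prop)).trans
      integral_sub_doublyTruncNormal
  have hY3 (i : ℕ) : Integrable (fun ω ↦ |Y i ω| ^ 3) P := by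
    have h := integrable_abs_sub_pow_three_doublyTruncNormal (μ := μ i) (hη0 i) (hρ0 i)
    rwa [← (hX i).map_eq, integrable_map_measure (by fun_prop) (hXm i)] at h
  have hYK (i : ℕ) : ∫ ω, |Y i ω| ^ 3 ∂P ≤ (stdNormalCDF ρ_min - stdNormalCDF (-ρ_min))⁻¹ *
      (η_max ^ 3 * ∫ z, |z| ^ 3 ∂(gaussianReal 0 1)) := by
    refine ((hX i).integral_comp (f := fun x ↦ |x - μ i| ^ 3) (by fun_prop)).trans_le
      ((integral_abs_sub_pow_three_doublyTruncNormal_le (hη0 i) hρ_min (hρ i)).trans ?_)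
    have h1 := (hη i).2
    have h2 := hη0 i
    have h3 : 0 ≤ ∫ z, |z| ^ 3 ∂(gaussianReal 0 1) := integral_nonneg fun z ↦ by positivity
    gcongr
  have hY2 (i : ℕ) : Integrable (fun ω ↦ Y i ω ^ 2) P :=
    integrable_pow_of_integrable_abs_pow (hYm i) (show 2 ≤ 3 by norm_num) (hY3 i)
  have hvar (i : ℕ) : Var[Y i; P] = Var[X i; P] :=
    variance_sub_const (hXm i).aestronglyMeasurable (μ i)
  obtain ⟨v, hv0, hv⟩ : ∃ v : ℝ, 0 < v ∧ ∀ i, v ≤ Var[Y i; P] := by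
    refine ⟨1 / (32 * ((stdNormalCDF ρ_min - stdNormalCDF (-ρ_min))⁻¹ * (1 / η_min)) ^ 2),
      by positivity, fun i ↦ ?_⟩
    -- Total mass 1 is inherited from `P` through the law of `X i`, which avoids integrating the
    -- density.
    have : IsProbabilityMeasure (doublyTruncNormal (μ i) (η i) (ρ i)) :=
      (hX i).isProbabilityMeasure_iff.1 inferInstance
    have h2 := hY2 i
    rw [variance_of_integral_eq_zero (hYm i) (hY0 i)]
    refine (le_integral_sq_sub_of_le_smul_volume (by positivity)
      (doublyTruncNormal_le_smul_volume hη_min (hη i).1 hρ_min (hρ i)) (μ i) ?_).trans_eq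
      ((hX i).integral_comp (f := fun x ↦ (x - μ i) ^ 2) (by fun_prop)).symm
    rw [← (hX i).map_eq, integrable_map_measure (by fun_prop) (hXm i)]
    exact h2
  refine ⟨fun i ↦ ?_, fun n hn ↦ ?_, ?_⟩
  · have h := ((memLp_two_iff_integrable_sq (hYm i).aestronglyMeasurable).2 (hY2 i)).add
      (memLp_const (μ i))
    refine h.ae_eq (ae_of_all _ fun ω ↦ ?_)
    simp [Y]
  · refine Real.sqrt_pos.2 (Finset.sum_pos (fun i _ ↦ ?_) ⟨0, Finset.mem_range.2 hn⟩)
    rw [← hvar]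
    exact hv0.trans_le (hv i)
  · simpa only [hvar] using
      tendstoInDistribution_of_integral_abs_pow_three_le hYm hYi hY0 hY3 hYK hv0 hv
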